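/- Let $A$ be a finite alphabet. A shift on $\mathbb{Z}^2$ over $A$ is a closed (for the product topology) translation-invariant set of configurations $x:\mathbb{Z}^2\to A$; equivalently, it is the set of all configurations in which no pattern from some set of forbidden finite patterns appears. A shift is effective if it can be defined by a recursively enumerable set of forbidden finite patterns, and of finite type if it can be defined by a finite set of forbidden finite patterns. A shift $S$ over $A$ is sofic if there are a finite alphabet $B$, a shift of finite type $T$ over $B$ and a map $\pi:B\to A$ such that $S=\{\pi\circ y : y\in T\}$. A pattern is globally admissible for $S$ if it appears in some configuration of $S$. Theorem. There exist a finite alphabet $A$ and a non-empty shift $S$ on $\mathbb{Z}^2$ over $A$ which is effective and not sofic, and which has polynomial block complexity: there is a polynomial $p$ such that for every $n$ the number of globally admissible patterns of $S$ of size $n\times n$ is at most $p(n)$. -/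

import Mathlib

open SymbolicDynamics.FullShift

namespace PlaneShift

/-- Finite patterns over `A` with support in `ℤ²` (Mathlib's notion). -/
abbrev Pat (A : Type) [Inhabited A] : Type := Pattern A (ℤ × ℤ)

/-- A finite list of pairs (cell, letter) is a code of the pattern `p` if it lists exactly the
graph of `p` on its support (in any order, repetitions allowed). A list that gives two different
letters to the same cell codes no pattern; every pattern has a code. -/
def Codes {A : Type} [Inhabited A] (w : List ((ℤ × ℤ) × A)) (p : Pat A) : Prop :=
  ∀ (g : ℤ × ℤ) (a : A), (g, a) ∈ w ↔ g ∈ p.support ∧ p.config g = a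

/-- A set of finite patterns is recursively enumerable: it is the set of patterns coded by the
members of a recursively enumerable set of codes. -/
def IsREPatternSet {A : Type} [Inhabited A] [Primcodable A] (F : Set (Pat A)) : Prop :=
  ∃ W : Set (List ((ℤ × ℤ) × A)),
    REPred (fun w => w ∈ W) ∧ F = {p | ∃ w ∈ W, Codes w p}

/-- An effective shift on `ℤ²`: it is defined by a recursively enumerable set of forbidden finite
patterns. -/
def IsEffective {A : Type} [Inhabited A] [TopologicalSpace A] [Primcodable A]
    (S : Subshift A (ℤ × ℤ)) : Prop :=
  ∃ F : Set (Pat A), IsREPatternSet F ∧ S.carrier = forbidden F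

/-- A shift of finite type on `ℤ²`: it is defined by a finite set of forbidden finite patterns. -/
def IsFiniteType {A : Type} [Inhabited A] [TopologicalSpace A]
    (S : Subshift A (ℤ × ℤ)) : Prop :=
  ∃ F : Set (Pat A), F.Finite ∧ S.carrier = forbidden F

/-- A sofic shift on `ℤ²`: it is the image of a shift of finite type, over some finite alphabet
(up to renaming, `{0, …, m}`), under a letter-to-letter projection applied cell by cell. -/
def IsSofic {A : Type} [TopologicalSpace A] (S : Subshift A (ℤ × ℤ)) : Prop :=
  ∃ (m : ℕ) (T : Subshift (Fin (m + 1)) (ℤ × ℤ)) (π : Fin (m + 1) → A),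
    IsFiniteType T ∧ S.carrier = (fun y : ℤ × ℤ → Fin (m + 1) => π ∘ y) '' T.carrier

/-- The `n × n` square `{0, …, n - 1}²`. -/
noncomputable def square (n : ℕ) : Finset (ℤ × ℤ) :=
  Finset.Ico (0 : ℤ) n ×ˢ Finset.Ico (0 : ℤ) n

/-- The globally admissible `n × n` patterns of `S`: the patterns with support the `n × n` square
that appear somewhere in some configuration of `S`. -/
def admissibleBlocks {A : Type} [Inhabited A] [TopologicalSpace A]
    (S : Subshift A (ℤ × ℤ)) (n : ℕ) : Set (Pat A) :=
  {p | p.support = square n ∧ ∃ x ∈ S.carrier, ∃ g : ℤ × ℤ, p.occursInAt x g}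

end PlaneShift

namespace PlaneShift

/-! ### Closure properties of primitive recursive predicates -/

section Primrec

variable {α : Type*} [Primcodable α]

/-! In a sofic shift, everything that crosses the boundary of an `n × n` square passes through
`O(n)` letters of the finite-type cover. A square storing far more than `n` bits, all forced by the
outside, therefore contradicts soficness. Polynomial complexity leaves no room for many contents per
square, so each size gets a single content, chosen by diagonalization.

The box of spacing `s` has side `s ^ 4` and stores `s ^ 6` bits at the cells whose coordinates are
multiples of `s`; the rest is blank. The shift consists of the translates of one box per `s`, on a
blank background, and the configurations with at most one nonblank cell, which absorb the limits as
`s` grows. The number `s` also encodes a finite-type shift and a projection, by window size, allowed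
windows and letter map. A boundary strip of width `R` over `M` letters has at most `M ^ (4 * R * s ^
4)` contents, fewer than `2 ^ s ^ 6` once `4 * R * M < s ^ 2`. So some content is not determined by
the strip of any of its preimages (`exists_not_determined`), and `payload s` is such a content.

If the shift were sofic, take the `s` encoding its cover. A preimage of the box could be changed
inside its strip so that its projection changes too (`not_isSofic_of_carrier_eq`). But the marked
cells on the two axes already force the whole box (`eq_conf_of_mem_sparseBoxes`).

The search for `payload s` is bounded, which gives effectiveness. A window of side `N` sees at most
one nonblank cell if `s > N`; otherwise only `s` and a polynomially bounded offset remain to be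
chosen (`good_of_mem_sparseBoxes`). -/

theorem primrecPred_forall_lt {f : α → ℕ} {p : α → ℕ → Prop} (hf : Primrec f)
    (hp : PrimrecPred fun x : α × ℕ => p x.1 x.2) : PrimrecPred fun a => ∀ i < f a, p a i := by
  have h : PrimrecRel fun (i : ℕ) (a : α) => p a i :=
    hp.comp (Primrec.snd.pair Primrec.fst)
  exact (h.forall_mem_list.comp (Primrec.list_range.comp hf) Primrec.id).of_eq (by simp)

theorem primrecPred_exists_lt {f : α → ℕ} {p : α → ℕ → Prop} (hf : Primrec f)
    (hp : PrimrecPred fun x : α × ℕ => p x.1 x.2) : PrimrecPred fun a => ∃ i < f a, p a i := by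
  have h : PrimrecRel fun (i : ℕ) (a : α) => p a i :=
    hp.comp (Primrec.snd.pair Primrec.fst)
  exact (h.exists_mem_list.comp (Primrec.list_range.comp hf) Primrec.id).of_eq (by simp)

theorem primrecPred_imp {p q : α → Prop} (hp : PrimrecPred p) (hq : PrimrecPred q) :
    PrimrecPred fun a => p a → q a :=
  (hp.not.or hq).of_eq fun _ => imp_iff_not_or.symm

theorem primrecPred_eq {β : Type*} [Primcodable β] {f g : α → β} (hf : Primrec f)
    (hg : Primrec g) : PrimrecPred fun a => f a = g a :=
  Primrec.eq.comp hf hg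

theorem primrecPred_lt {f g : α → ℕ} (hf : Primrec f) (hg : Primrec g) :
    PrimrecPred fun a => f a < g a :=
  Primrec.nat_lt.comp hf hg

theorem primrecPred_le {f g : α → ℕ} (hf : Primrec f) (hg : Primrec g) :
    PrimrecPred fun a => f a ≤ g a :=
  Primrec.nat_le.comp hf hg

theorem primrec_add {f g : α → ℕ} (hf : Primrec f) (hg : Primrec g) :
    Primrec fun a => f a + g a :=
  Primrec.nat_add.comp hf hg

theorem primrec_sub {f g : α → ℕ} (hf : Primrec f) (hg : Primrec g) :
    Primrec fun a => f a - g a :=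
  Primrec.nat_sub.comp hf hg

theorem primrec_mul {f g : α → ℕ} (hf : Primrec f) (hg : Primrec g) :
    Primrec fun a => f a * g a :=
  Primrec.nat_mul.comp hf hg

theorem primrec_div {f g : α → ℕ} (hf : Primrec f) (hg : Primrec g) :
    Primrec fun a => f a / g a :=
  Primrec.nat_div.comp hf hg

theorem primrec_mod {f g : α → ℕ} (hf : Primrec f) (hg : Primrec g) :
    Primrec fun a => f a % g a :=
  Primrec.nat_mod.comp hf hg

theorem primrec_pow {f g : α → ℕ} (hf : Primrec f) (hg : Primrec g) :
    Primrec fun a => f a ^ g a :=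
  (Primrec₂.unpaired'.1 Nat.Primrec.pow).comp hf hg

theorem primrec_unpair_fst {f : α → ℕ} (hf : Primrec f) : Primrec fun a => (f a).unpair.1 :=
  Primrec.fst.comp (Primrec.unpair.comp hf)

theorem primrec_unpair_snd {f : α → ℕ} (hf : Primrec f) : Primrec fun a => (f a).unpair.2 :=
  Primrec.snd.comp (Primrec.unpair.comp hf)

/-- The projection of a decidable relation to its first coordinate is recursively enumerable. -/
theorem rePred_exists_nat {R : α → ℕ → Prop} (hR : PrimrecPred fun x : α × ℕ => R x.1 x.2) :
    REPred fun a => ∃ n, R a n := by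
  classical
  have h : Partrec₂ fun (a : α) => ((fun n => decide (R a n) : ℕ → Bool) : ℕ →. Bool) :=
    Computable.partrec hR.decide.to_comp
  refine (Partrec.dom_re (Partrec.rfind h)).of_eq fun a => ?_
  rw [Nat.rfind_dom]
  simp

end Primrec

/-! ### Digits -/

/-- The digit of `Q` with index `k` in base `B`. -/
def digit (B Q k : ℕ) : ℕ := Q / B ^ k % B

theorem digit_lt {B : ℕ} (hB : 0 < B) (Q k : ℕ) : digit B Q k < B := Nat.mod_lt _ hB

theorem digit_zero (B Q : ℕ) : digit B Q 0 = Q % B := by simp [digit]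

theorem digit_succ (B Q k : ℕ) : digit B Q (k + 1) = digit B (Q / B) k := by
  rw [digit, digit, pow_succ', Nat.div_div_eq_div_mul]

/-- The bound on the code is what later turns quantifiers over arrays and windows into bounded ones,
hence primitive recursive. -/
theorem exists_digit_eq {B : ℕ} (hB : 0 < B) (K : ℕ) (f : ℕ → ℕ) (hf : ∀ k < K, f k < B) :
    ∃ Q < B ^ K, ∀ k < K, digit B Q k = f k := by
  induction K generalizing f with
  | zero => exact ⟨0, by simp, by simp⟩
  | succ K ih =>
    obtain ⟨Q, hQ, h⟩ := ih (fun k => f (k + 1)) fun k hk => hf _ (by omega)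
    have h0 := hf 0 (by omega)
    refine ⟨f 0 + B * Q, ?_, fun k hk => ?_⟩
    · rw [pow_succ']
      nlinarith
    · cases k with
      | zero => rw [digit_zero, Nat.add_mul_mod_self_left, Nat.mod_eq_of_lt h0]
      | succ k =>
        rw [digit_succ, Nat.add_mul_div_left _ _ hB, Nat.div_eq_of_lt h0, zero_add]
        exact h k (by omega)

theorem eq_of_digit_eq {B : ℕ} (K : ℕ) {P Q : ℕ} (hP : P < B ^ K) (hQ : Q < B ^ K)
    (h : ∀ k < K, digit B P k = digit B Q k) : P = Q := by
  induction K generalizing P Q with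
  | zero => simp at hP hQ; omega
  | succ K ih =>
    have h0 := h 0 (by omega)
    rw [digit_zero, digit_zero] at h0
    rw [pow_succ'] at hP hQ
    have := ih (Nat.div_lt_of_lt_mul hP) (Nat.div_lt_of_lt_mul hQ) fun k hk => by
      rw [← digit_succ, ← digit_succ]; exact h _ (by omega)
    rw [← Nat.div_add_mod P B, ← Nat.div_add_mod Q B, h0, this]

/-- A square array with entries below `B` is coded by a number. -/
theorem exists_digit_square {B : ℕ} (hB : 0 < B) (n : ℕ) (f : ℕ → ℕ → ℕ)
    (hf : ∀ i < n, ∀ j < n, f i j < B) :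
    ∃ Q < B ^ (n * n), ∀ i < n, ∀ j < n, digit B Q (i * n + j) = f i j := by
  obtain ⟨Q, hQ, h⟩ := exists_digit_eq hB (n * n) (fun k => f (k / n) (k % n)) fun k hk =>
    hf _ (Nat.div_lt_of_lt_mul hk) _ (Nat.mod_lt _ (Nat.pos_of_ne_zero (by rintro rfl; simp at hk)))
  refine ⟨Q, hQ, fun i hi j hj => ?_⟩
  have hn : 0 < n := by omega
  rw [h _ (by nlinarith), mul_comm, Nat.mul_add_div hn, Nat.mul_add_mod,
    Nat.div_eq_of_lt hj, Nat.mod_eq_of_lt hj, add_zero]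

theorem primrec_digit {α : Type*} [Primcodable α] {f g h : α → ℕ} (hf : Primrec f)
    (hg : Primrec g) (hh : Primrec h) : Primrec fun a => digit (f a) (g a) (h a) :=
  primrec_mod (primrec_div hg (primrec_pow hf hh)) hf

/-! ### The diagonal construction -/

/-- The letter in the cell `(i, j)` of the box of spacing `s` whose bits are those of `p`. -/
def cell (s p i j : ℕ) : ℕ :=
  if i % s = 0 ∧ j % s = 0 then 1 + digit 2 p (i / s * s ^ 3 + j / s) else 0

/-- `Q` codes an `n × n` array over `M` letters, all of whose `R × R` windows are allowed, where
the digits of `f` tell which windows are allowed. -/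
def Valid (M R f n Q : ℕ) : Prop :=
  ∀ i < n, ∀ j < n, (i + R ≤ n ∧ j + R ≤ n) → ∀ v < M ^ (R * R),
    (∀ a < R, ∀ b < R, digit M v (a * R + b) = digit M Q ((i + a) * n + (j + b))) →
      digit 2 f v = 1

/-- The array coded by `Q` is projected by `c` to the box of spacing `s` with bits `p`. -/
def Projects (M c s p Q : ℕ) : Prop :=
  ∀ i < s ^ 4, ∀ j < s ^ 4, digit 3 c (digit M Q (i * s ^ 4 + j)) = cell s p i j

/-- The arrays coded by `Q` and `Q'` agree at distance less than `R` from the boundary. -/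
def AgreeNearBoundary (M R n Q Q' : ℕ) : Prop :=
  ∀ i < n, ∀ j < n, ((i < R ∨ j < R) ∨ (n ≤ i + R ∨ n ≤ j + R)) →
    digit M Q (i * n + j) = digit M Q' (i * n + j)

/-- The box of spacing `s` with bits `p` is determined by the boundary of some array that projects
to it, with respect to the shift of finite type and the projection given by `M`, `R`, `f`, `c`. -/
def Determined (M R f c s p : ℕ) : Prop :=
  ∃ Q < M ^ (s ^ 4 * s ^ 4), (Valid M R f (s ^ 4) Q ∧ Projects M c s p Q) ∧
    ∀ Q' < M ^ (s ^ 4 * s ^ 4), Valid M R f (s ^ 4) Q' → AgreeNearBoundary M R (s ^ 4) Q Q' →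
      Projects M c s p Q'

/-- `Determined`, with the parameters read off from `s`. -/
def DeterminedAt (s p : ℕ) : Prop :=
  Determined (s.unpair.1.unpair.1.unpair.1 + 1) s.unpair.1.unpair.1.unpair.2
    s.unpair.1.unpair.2.unpair.1 s.unpair.1.unpair.2.unpair.2 s p

open Classical in
/-- A box content of spacing `s` that is not determined by its boundary, if there is one. -/
noncomputable def payload (s : ℕ) : ℕ :=
  Nat.findGreatest (fun p => ¬ DeterminedAt s p) (2 ^ s ^ 6 - 1)

/-- The quadrant `ℕ²` with the box of spacing `s` in its corner. -/
noncomputable def boxVal (s i j : ℕ) : ℕ :=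
  if i < s ^ 4 ∧ j < s ^ 4 then cell s (payload s) i j else 0

/-- The quadrant of `boxVal`, extended by blanks and moved by `N`. -/
noncomputable def paddedVal (s N i j : ℕ) : ℕ :=
  if N ≤ i ∧ N ≤ j then boxVal s (i - N) (j - N) else 0

/-- The `N × N` array coded by `q` has at most one nonblank cell. -/
def AtMostOne (N q : ℕ) : Prop :=
  ∃ u < N + 1, ∃ v < N + 1, ∀ i < N, ∀ j < N, ¬ (i = u ∧ j = v) → digit 3 q (i * N + j) = 0

/-- The `N × N` array coded by `q` is a window of a box of spacing at most `N`. -/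
def IsBoxWindow (N q : ℕ) : Prop :=
  ∃ s < N + 1, ∃ a < N ^ 4 + N + 1, ∃ b < N ^ 4 + N + 1, ∀ i < N, ∀ j < N,
    digit 3 q (i * N + j) = paddedVal s N (i + a) (j + b)

/-- The `N × N` array coded by `q` is admissible. -/
def Good (N q : ℕ) : Prop := AtMostOne N q ∨ IsBoxWindow N q

/-! ### Computability of the construction -/

section Primrec

variable {α : Type*} [Primcodable α]

theorem primrec_cell {s p i j : α → ℕ} (hs : Primrec s) (hp : Primrec p) (hi : Primrec i)
    (hj : Primrec j) : Primrec fun a => cell (s a) (p a) (i a) (j a) :=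
  Primrec.ite ((primrecPred_eq (primrec_mod hi hs) (.const 0)).and
      (primrecPred_eq (primrec_mod hj hs) (.const 0)))
    (primrec_add (.const 1) (primrec_digit (.const 2) hp
      (primrec_add (primrec_mul (primrec_div hi hs) (primrec_pow hs (.const 3)))
        (primrec_div hj hs)))) (.const 0)

theorem primrecPred_valid {M R f n Q : α → ℕ} (hM : Primrec M) (hR : Primrec R) (hf : Primrec f)
    (hn : Primrec n) (hQ : Primrec Q) :
    PrimrecPred fun a => Valid (M a) (R a) (f a) (n a) (Q a) := by
  have h1 : Primrec fun x : α × ℕ => x.1 := Primrec.fst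
  have h2 : Primrec fun x : (α × ℕ) × ℕ => x.1.1 := h1.comp .fst
  have h3 : Primrec fun x : ((α × ℕ) × ℕ) × ℕ => x.1.1.1 := h2.comp .fst
  have h4 : Primrec fun x : (((α × ℕ) × ℕ) × ℕ) × ℕ => x.1.1.1.1 := h3.comp .fst
  have h5 : Primrec fun x : ((((α × ℕ) × ℕ) × ℕ) × ℕ) × ℕ => x.1.1.1.1.1 := h4.comp .fst
  have i2 : Primrec fun x : (α × ℕ) × ℕ => x.1.2 := Primrec.snd.comp .fst
  have j2 : Primrec fun x : (α × ℕ) × ℕ => x.2 := Primrec.snd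
  have i5 : Primrec fun x : ((((α × ℕ) × ℕ) × ℕ) × ℕ) × ℕ => x.1.1.1.1.2 :=
    i2.comp ((Primrec.fst.comp .fst).comp .fst)
  have j5 : Primrec fun x : ((((α × ℕ) × ℕ) × ℕ) × ℕ) × ℕ => x.1.1.1.2 :=
    j2.comp ((Primrec.fst.comp .fst).comp .fst)
  have v5 : Primrec fun x : ((((α × ℕ) × ℕ) × ℕ) × ℕ) × ℕ => x.1.1.2 :=
    Primrec.snd.comp (Primrec.fst.comp .fst)
  have a5 : Primrec fun x : ((((α × ℕ) × ℕ) × ℕ) × ℕ) × ℕ => x.1.2 := Primrec.snd.comp .fst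
  refine primrecPred_forall_lt hn <| primrecPred_forall_lt (hn.comp h1) <|
    primrecPred_imp (.and
      (primrecPred_le (primrec_add i2 (hR.comp h2)) (hn.comp h2))
      (primrecPred_le (primrec_add j2 (hR.comp h2)) (hn.comp h2))) <|
    primrecPred_forall_lt (primrec_pow (hM.comp h2) (primrec_mul (hR.comp h2) (hR.comp h2))) <|
    primrecPred_imp (primrecPred_forall_lt (hR.comp h3) <| primrecPred_forall_lt (hR.comp h4) <|
      primrecPred_eq
        (primrec_digit (hM.comp h5) v5 (primrec_add (primrec_mul a5 (hR.comp h5)) .snd))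
        (primrec_digit (hM.comp h5) (hQ.comp h5)
          (primrec_add (primrec_mul (primrec_add i5 a5) (hn.comp h5)) (primrec_add j5 .snd)))) <|
    primrecPred_eq (primrec_digit (.const 2) (hf.comp h3) .snd) (.const 1)

theorem primrecPred_projects {M c s p Q : α → ℕ} (hM : Primrec M) (hc : Primrec c)
    (hs : Primrec s) (hp : Primrec p) (hQ : Primrec Q) :
    PrimrecPred fun a => Projects (M a) (c a) (s a) (p a) (Q a) := by
  have h1 : Primrec fun x : α × ℕ => x.1 := Primrec.fst
  have h2 : Primrec fun x : (α × ℕ) × ℕ => x.1.1 := h1.comp .fst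
  have i2 : Primrec fun x : (α × ℕ) × ℕ => x.1.2 := Primrec.snd.comp .fst
  have hs4 := primrec_pow hs (.const 4)
  refine primrecPred_forall_lt hs4 <| primrecPred_forall_lt (hs4.comp h1) <|
    primrecPred_eq (primrec_digit (.const 3) (hc.comp h2) (primrec_digit (hM.comp h2) (hQ.comp h2)
      (primrec_add (primrec_mul i2 (hs4.comp h2)) .snd)))
      (primrec_cell (hs.comp h2) (hp.comp h2) i2 .snd)

theorem primrecPred_agree {M R n Q Q' : α → ℕ} (hM : Primrec M) (hR : Primrec R)
    (hn : Primrec n) (hQ : Primrec Q) (hQ' : Primrec Q') :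
    PrimrecPred fun a => AgreeNearBoundary (M a) (R a) (n a) (Q a) (Q' a) := by
  have h1 : Primrec fun x : α × ℕ => x.1 := Primrec.fst
  have h2 : Primrec fun x : (α × ℕ) × ℕ => x.1.1 := h1.comp .fst
  have i2 : Primrec fun x : (α × ℕ) × ℕ => x.1.2 := Primrec.snd.comp .fst
  have k2 := primrec_add (primrec_mul i2 (hn.comp h2)) Primrec.snd
  refine primrecPred_forall_lt hn <| primrecPred_forall_lt (hn.comp h1) <| primrecPred_imp
    (((primrecPred_lt i2 (hR.comp h2)).or (primrecPred_lt .snd (hR.comp h2))).or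
      ((primrecPred_le (hn.comp h2) (primrec_add i2 (hR.comp h2))).or
      (primrecPred_le (hn.comp h2) (primrec_add .snd (hR.comp h2))))) <|
    primrecPred_eq (primrec_digit (hM.comp h2) (hQ.comp h2) k2)
      (primrec_digit (hM.comp h2) (hQ'.comp h2) k2)

theorem primrecPred_determined {M R f c s p : α → ℕ} (hM : Primrec M) (hR : Primrec R)
    (hf : Primrec f) (hc : Primrec c) (hs : Primrec s) (hp : Primrec p) :
    PrimrecPred fun a => Determined (M a) (R a) (f a) (c a) (s a) (p a) := by
  have h1 : Primrec fun x : α × ℕ => x.1 := Primrec.fst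
  have h2 : Primrec fun x : (α × ℕ) × ℕ => x.1.1 := h1.comp .fst
  have hs4 := primrec_pow hs (.const 4)
  have hb := primrec_pow hM (primrec_mul hs4 hs4)
  refine primrecPred_exists_lt hb <| .and (.and
    (primrecPred_valid (hM.comp h1) (hR.comp h1) (hf.comp h1) (hs4.comp h1) .snd)
    (primrecPred_projects (hM.comp h1) (hc.comp h1) (hs.comp h1) (hp.comp h1) .snd)) <|
    primrecPred_forall_lt (hb.comp h1) <| primrecPred_imp
    (primrecPred_valid (hM.comp h2) (hR.comp h2) (hf.comp h2) (hs4.comp h2) .snd) <|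
    primrecPred_imp
    (primrecPred_agree (hM.comp h2) (hR.comp h2) (hs4.comp h2) (Primrec.snd.comp .fst) .snd) <|
    primrecPred_projects (hM.comp h2) (hc.comp h2) (hs.comp h2) (hp.comp h2) .snd

/-- Being determined only involves quantifiers with explicit bounds, and the candidate contents are
bounded too, so the diagonal choice is computable. -/
theorem primrec_payload : Primrec payload := by
  classical
  have h : PrimrecRel fun s p : ℕ => ¬ DeterminedAt s p := by
    have hs : Primrec fun x : ℕ × ℕ => x.1 := Primrec.fst
    have h1 := primrec_unpair_fst hs
    have h11 := primrec_unpair_fst h1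
    have h12 := primrec_unpair_snd h1
    exact (primrecPred_determined (primrec_add (primrec_unpair_fst h11) (.const 1))
      (primrec_unpair_snd h11) (primrec_unpair_fst h12) (primrec_unpair_snd h12) hs .snd).not
  refine (Primrec.nat_findGreatest
    (primrec_sub (primrec_pow (.const 2) (primrec_pow .id (.const 6))) (.const 1)) h).of_eq
    fun s => ?_
  unfold payload
  congr

theorem primrec_boxVal {s i j : α → ℕ} (hs : Primrec s) (hi : Primrec i) (hj : Primrec j) :
    Primrec fun a => boxVal (s a) (i a) (j a) := by
  have hs4 := primrec_pow hs (.const 4)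
  exact Primrec.ite ((primrecPred_lt hi hs4).and (primrecPred_lt hj hs4))
    (primrec_cell hs (primrec_payload.comp hs) hi hj) (.const 0)

theorem primrec_paddedVal {s N i j : α → ℕ} (hs : Primrec s) (hN : Primrec N) (hi : Primrec i)
    (hj : Primrec j) : Primrec fun a => paddedVal (s a) (N a) (i a) (j a) :=
  Primrec.ite ((primrecPred_le hN hi).and (primrecPred_le hN hj))
    (primrec_boxVal hs (primrec_sub hi hN) (primrec_sub hj hN)) (.const 0)

theorem primrecPred_atMostOne {N q : α → ℕ} (hN : Primrec N) (hq : Primrec q) :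
    PrimrecPred fun a => AtMostOne (N a) (q a) := by
  have h1 : Primrec fun x : α × ℕ => x.1 := Primrec.fst
  have h2 : Primrec fun x : (α × ℕ) × ℕ => x.1.1 := h1.comp .fst
  have h3 : Primrec fun x : ((α × ℕ) × ℕ) × ℕ => x.1.1.1 := h2.comp .fst
  have h4 : Primrec fun x : (((α × ℕ) × ℕ) × ℕ) × ℕ => x.1.1.1.1 := h3.comp .fst
  have u4 : Primrec fun x : (((α × ℕ) × ℕ) × ℕ) × ℕ => x.1.1.1.2 :=
    Primrec.snd.comp (.comp .fst (.comp .fst .fst))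
  have v4 : Primrec fun x : (((α × ℕ) × ℕ) × ℕ) × ℕ => x.1.1.2 :=
    Primrec.snd.comp (.comp .fst .fst)
  have i4 : Primrec fun x : (((α × ℕ) × ℕ) × ℕ) × ℕ => x.1.2 := Primrec.snd.comp .fst
  have hN1 := primrec_add hN (.const 1)
  exact primrecPred_exists_lt hN1 <| primrecPred_exists_lt (hN1.comp h1) <|
    primrecPred_forall_lt (hN.comp h2) <| primrecPred_forall_lt (hN.comp h3) <|
    primrecPred_imp ((primrecPred_eq i4 u4).and (primrecPred_eq .snd v4)).not <|
    primrecPred_eq (primrec_digit (.const 3) (hq.comp h4)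
      (primrec_add (primrec_mul i4 (hN.comp h4)) .snd)) (.const 0)

theorem primrecPred_isBoxWindow {N q : α → ℕ} (hN : Primrec N) (hq : Primrec q) :
    PrimrecPred fun a => IsBoxWindow (N a) (q a) := by
  have h1 : Primrec fun x : α × ℕ => x.1 := Primrec.fst
  have h2 : Primrec fun x : (α × ℕ) × ℕ => x.1.1 := h1.comp .fst
  have h3 : Primrec fun x : ((α × ℕ) × ℕ) × ℕ => x.1.1.1 := h2.comp .fst
  have h4 : Primrec fun x : (((α × ℕ) × ℕ) × ℕ) × ℕ => x.1.1.1.1 := h3.comp .fst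
  have h5 : Primrec fun x : ((((α × ℕ) × ℕ) × ℕ) × ℕ) × ℕ => x.1.1.1.1.1 := h4.comp .fst
  have s5 : Primrec fun x : ((((α × ℕ) × ℕ) × ℕ) × ℕ) × ℕ => x.1.1.1.1.2 :=
    Primrec.snd.comp (.comp .fst (.comp .fst (.comp .fst .fst)))
  have a5 : Primrec fun x : ((((α × ℕ) × ℕ) × ℕ) × ℕ) × ℕ => x.1.1.1.2 :=
    Primrec.snd.comp (.comp .fst (.comp .fst .fst))
  have b5 : Primrec fun x : ((((α × ℕ) × ℕ) × ℕ) × ℕ) × ℕ => x.1.1.2 :=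
    Primrec.snd.comp (.comp .fst .fst)
  have i5 : Primrec fun x : ((((α × ℕ) × ℕ) × ℕ) × ℕ) × ℕ => x.1.2 := Primrec.snd.comp .fst
  have hN1 := primrec_add hN (.const 1)
  have hN4 := primrec_add (primrec_add (primrec_pow hN (.const 4)) hN) (.const 1)
  exact primrecPred_exists_lt hN1 <| primrecPred_exists_lt (hN4.comp h1) <|
    primrecPred_exists_lt (hN4.comp h2) <|
    primrecPred_forall_lt (hN.comp h3) <| primrecPred_forall_lt (hN.comp h4) <|
    primrecPred_eq (primrec_digit (.const 3) (hq.comp h5)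
      (primrec_add (primrec_mul i5 (hN.comp h5)) .snd))
    (primrec_paddedVal s5 (hN.comp h5) (primrec_add i5 a5) (primrec_add .snd b5))

theorem primrecPred_good {N q : α → ℕ} (hN : Primrec N) (hq : Primrec q) :
    PrimrecPred fun a => Good (N a) (q a) :=
  (primrecPred_atMostOne hN hq).or (primrecPred_isBoxWindow hN hq)

end Primrec

/-! ### The shift -/

/-- The letters, as numbers, of the configuration with one box of spacing `s` at the origin. -/
noncomputable def confVal (s : ℕ) (h : ℤ × ℤ) : ℕ :=
  if 0 ≤ h.1 ∧ 0 ≤ h.2 then boxVal s h.1.toNat h.2.toNat else 0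

theorem cell_lt (s p i j : ℕ) : cell s p i j < 3 := by
  have := digit_lt (B := 2) (by norm_num) p (i / s * s ^ 3 + j / s)
  unfold cell
  split <;> omega

theorem boxVal_lt (s i j : ℕ) : boxVal s i j < 3 := by
  unfold boxVal
  split
  · exact cell_lt ..
  · norm_num

theorem confVal_lt (s : ℕ) (h : ℤ × ℤ) : confVal s h < 3 := by
  unfold confVal
  split
  · exact boxVal_lt ..
  · norm_num

/-- The configuration with one box of spacing `s` at the origin. -/
noncomputable def conf (s : ℕ) (h : ℤ × ℤ) : Fin 3 := ⟨confVal s h, confVal_lt s h⟩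

theorem confVal_ne_zero_iff (s : ℕ) (h : ℤ × ℤ) :
    confVal s h ≠ 0 ↔ (0 ≤ h.1 ∧ h.1 < (s : ℤ) ^ 4) ∧ (0 ≤ h.2 ∧ h.2 < (s : ℤ) ^ 4) ∧
      (s : ℤ) ∣ h.1 ∧ (s : ℤ) ∣ h.2 := by
  obtain ⟨a, b⟩ := h
  by_cases h : 0 ≤ a ∧ 0 ≤ b
  · obtain ⟨ha, hb⟩ := h
    lift a to ℕ using ha
    lift b to ℕ using hb
    simp only [confVal, boxVal, cell, Int.toNat_natCast, Int.natCast_nonneg, and_self, if_true,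
      true_and, ← Nat.dvd_iff_mod_eq_zero, Int.natCast_dvd_natCast]
    norm_cast
    split_ifs <;> simp <;> tauto
  · simp only [confVal, h, if_false]
    simp only [ne_eq, not_true_eq_false, false_iff]
    tauto

theorem conf_ne_zero_iff (s : ℕ) (h : ℤ × ℤ) :
    conf s h ≠ 0 ↔ (0 ≤ h.1 ∧ h.1 < (s : ℤ) ^ 4) ∧ (0 ≤ h.2 ∧ h.2 < (s : ℤ) ^ 4) ∧
      (s : ℤ) ∣ h.1 ∧ (s : ℤ) ∣ h.2 := by
  rw [← confVal_ne_zero_iff, conf, ne_eq, Fin.ext_iff]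
  rfl

theorem paddedVal_eq (s N i j : ℕ) :
    paddedVal s N i j = confVal s ((i : ℤ) - N, (j : ℤ) - N) := by
  unfold paddedVal confVal
  simp only [sub_nonneg, Nat.cast_le]
  split_ifs with h
  · congr 1 <;> omega
  · rfl

/-- Nonblank cells that are closer than the spacing coincide. -/
theorem eq_of_conf_ne_zero {s : ℕ} {h k : ℤ × ℤ} (hh : conf s h ≠ 0) (hk : conf s k ≠ 0)
    (h1 : |h.1 - k.1| < s) (h2 : |h.2 - k.2| < s) : h = k := by
  rw [conf_ne_zero_iff] at hh hk
  have e1 := Int.eq_zero_of_abs_lt_dvd (dvd_sub hh.2.2.1 hk.2.2.1) h1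
  have e2 := Int.eq_zero_of_abs_lt_dvd (dvd_sub hh.2.2.2 hk.2.2.2) h2
  exact Prod.ext (by omega) (by omega)

/-- The configurations with at most one nonblank cell and the translates of the boxes. -/
def sparseBoxes : Set (ℤ × ℤ → Fin 3) :=
  {x | (∃ u, ∀ v, v ≠ u → x v = 0) ∨ ∃ (s : ℕ) (t : ℤ × ℤ), ∀ h, x h = conf s (h - t)}

/-- The number `q` codes the `N × N` block of `x` at `g`. -/
def CodesBlock (x : ℤ × ℤ → Fin 3) (g : ℤ × ℤ) (N q : ℕ) : Prop :=
  ∀ i < N, ∀ j < N, digit 3 q (i * N + j) = (x (g + ((i : ℤ), (j : ℤ)))).val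

theorem exists_codesBlock (x : ℤ × ℤ → Fin 3) (g : ℤ × ℤ) (N : ℕ) : ∃ q, CodesBlock x g N q := by
  obtain ⟨q, -, hq⟩ := exists_digit_square (B := 3) (by norm_num) N
    (fun i j => (x (g + ((i : ℤ), (j : ℤ)))).val) fun i _ j _ => Fin.is_lt _
  exact ⟨q, hq⟩

theorem atMostOne_of_codesBlock {x : ℤ × ℤ → Fin 3} {g : ℤ × ℤ} {N q : ℕ}
    (hq : CodesBlock x g N q)
    (h : ∀ i < N, ∀ j < N, x (g + ((i : ℤ), (j : ℤ))) ≠ 0 →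
      ∀ i' < N, ∀ j' < N, x (g + ((i' : ℤ), (j' : ℤ))) ≠ 0 → i' = i ∧ j' = j) :
    AtMostOne N q := by
  by_cases hex : ∃ i < N, ∃ j < N, x (g + ((i : ℤ), (j : ℤ))) ≠ 0
  · obtain ⟨i, hi, j, hj, hij⟩ := hex
    refine ⟨i, by omega, j, by omega, fun i' hi' j' hj' hne => ?_⟩
    rw [hq i' hi' j' hj']
    by_contra h0
    exact hne (h i hi j hj hij i' hi' j' hj' fun h => h0 (by rw [h]; rfl))
  · push Not at hex
    refine ⟨0, by omega, 0, by omega, fun i hi j hj _ => ?_⟩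
    rw [hq i hi j hj, hex i hi j hj]
    rfl

/-- Only spacings `s ≤ N` can put two nonblank cells in an `N × N` block, and then the offset of a
block meeting the box is at most about `N ^ 4`. This one fact serves both effectiveness and the
complexity bound. -/
theorem good_of_mem_sparseBoxes {x : ℤ × ℤ → Fin 3} (hx : x ∈ sparseBoxes) {g : ℤ × ℤ} {N q : ℕ}
    (hq : CodesBlock x g N q) : Good N q := by
  obtain ⟨u, hu⟩ | ⟨s, t, hs⟩ := hx
  · refine .inl (atMostOne_of_codesBlock hq fun i _ j _ hij i' _ j' _ hij' => ?_)
    have h1 : g + ((i : ℤ), (j : ℤ)) = u := by by_contra h; exact hij (hu _ h)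
    have h2 : g + ((i' : ℤ), (j' : ℤ)) = u := by by_contra h; exact hij' (hu _ h)
    have := add_left_cancel (h2.trans h1.symm)
    simpa using this
  · by_cases hsN : s ≤ N
    · by_cases hex : ∃ i < N, ∃ j < N, x (g + ((i : ℤ), (j : ℤ))) ≠ 0
      · obtain ⟨i, hi, j, hj, hij⟩ := hex
        rw [hs, conf_ne_zero_iff] at hij
        obtain ⟨⟨h1, h2⟩, ⟨h3, h4⟩, -⟩ := hij
        simp only [Prod.fst_sub, Prod.fst_add, Prod.snd_sub, Prod.snd_add] at h1 h2 h3 h4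
        have hpow : (s : ℤ) ^ 4 ≤ ((N ^ 4 : ℕ) : ℤ) := by
          exact_mod_cast Nat.pow_le_pow_left hsN 4
        generalize (s : ℤ) ^ 4 = S at *
        generalize hN4 : N ^ 4 = N4 at *
        -- A block that meets the box starts less than `N` cells before it, so adding `N` makes the
        -- offset a natural number.
        refine .inr ⟨s, by omega, (g.1 - t.1 + N).toNat, by omega, (g.2 - t.2 + N).toNat,
          by omega, fun i' hi' j' hj' => ?_⟩
        rw [hq i' hi' j' hj', hs, paddedVal_eq]
        change confVal _ _ = confVal _ _
        congr 1
        ext <;> simp <;> omega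
      · push Not at hex
        exact .inl (atMostOne_of_codesBlock hq fun i hi j hj hij => absurd (hex i hi j hj) hij)
    · refine .inl (atMostOne_of_codesBlock hq fun i hi j hj hij i' hi' j' hj' hij' => ?_)
      rw [hs] at hij hij'
      have := eq_of_conf_ne_zero hij' hij
        (by simp only [Prod.fst_sub, Prod.fst_add, abs_lt]; constructor <;> omega)
        (by simp only [Prod.snd_sub, Prod.snd_add, abs_lt]; constructor <;> omega)
      have := add_left_cancel (sub_left_injective this)
      simpa using this

/-- A local-to-global argument. Two nonblank cells at distance at most `d` force `s ≤ d` in every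
window containing both, so any box seen there stays within `d ^ 4` of either cell. One window large
enough to contain that region fixes the box, and larger windows show that the rest is blank. -/
theorem mem_sparseBoxes_of_good {x : ℤ × ℤ → Fin 3}
    (hx : ∀ g N q, CodesBlock x g N q → Good N q) : x ∈ sparseBoxes := by
  by_contra hmem
  obtain ⟨h1, h2⟩ := not_or.1 hmem
  push Not at h1 h2
  obtain ⟨u, -, hu⟩ := h1 0
  obtain ⟨v, huv, hv⟩ := h1 u
  obtain ⟨d, hd1, hd2⟩ : ∃ d : ℕ, |u.1 - v.1| ≤ d ∧ |u.2 - v.2| ≤ d :=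
    ⟨max (u.1 - v.1).natAbs (u.2 - v.2).natAbs, by rw [Int.abs_eq_natAbs]; omega,
      by rw [Int.abs_eq_natAbs]; omega⟩
  have key : ∀ K : ℕ, d ≤ K → ∃ (s : ℕ) (t : ℤ × ℤ),
      (∀ h : ℤ × ℤ, |h.1 - u.1| ≤ K → |h.2 - u.2| ≤ K → x h = conf s (h - t)) ∧
      ∀ h : ℤ × ℤ, (d : ℤ) ^ 4 < |h.1 - u.1| ∨ (d : ℤ) ^ 4 < |h.2 - u.2| →
        conf s (h - t) = 0 := by
    intro K hK
    obtain ⟨q, hq⟩ := exists_codesBlock x (u - ((K : ℤ), (K : ℤ))) (2 * K + 1)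
    have cells : ∀ h : ℤ × ℤ, |h.1 - u.1| ≤ K → |h.2 - u.2| ≤ K → ∃ i < 2 * K + 1,
        ∃ j < 2 * K + 1, u - ((K : ℤ), (K : ℤ)) + ((i : ℤ), (j : ℤ)) = h := by
      intro h hh1 hh2
      rw [abs_le] at hh1 hh2
      refine ⟨(h.1 - u.1 + K).toNat, by omega, (h.2 - u.2 + K).toNat, by omega, ?_⟩
      ext <;> simp <;> omega
    obtain ⟨a, -, c, -, hc⟩ | ⟨s, -, a, -, b, -, hs⟩ := hx _ _ _ hq
    · obtain ⟨i, hi, j, hj, hij⟩ := cells u (by simp) (by simp)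
      obtain ⟨i', hi', j', hj', hij'⟩ := cells v
        (by rw [abs_sub_comm]; omega) (by rw [abs_sub_comm]; omega)
      have e1 : i = a ∧ j = c := by
        by_contra hne
        have := hc i hi j hj hne
        rw [hq i hi j hj, hij] at this
        exact hu (Fin.ext this)
      have e2 : i' = a ∧ j' = c := by
        by_contra hne
        have := hc i' hi' j' hj' hne
        rw [hq i' hi' j' hj', hij'] at this
        exact hv (Fin.ext this)
      refine absurd ?_ huv
      rw [← hij, ← hij', e1.1, e1.2, e2.1, e2.2]
    · have hs' : ∀ h : ℤ × ℤ, |h.1 - u.1| ≤ K → |h.2 - u.2| ≤ K → x h =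
          conf s (h - (u + ((K : ℤ) + 1 - a, (K : ℤ) + 1 - b))) := by
        intro h hh1 hh2
        obtain ⟨i, hi, j, hj, rfl⟩ := cells h hh1 hh2
        apply Fin.ext
        rw [← hq i hi j hj, hs i hi j hj, paddedVal_eq, conf]
        congr 1
        ext <;> simp <;> ring
      refine ⟨s, u + ((K : ℤ) + 1 - a, (K : ℤ) + 1 - b), hs', fun h hh => ?_⟩
      generalize u + ((K : ℤ) + 1 - a, (K : ℤ) + 1 - b) = t at *
      have hu' := hu
      have hv' := hv
      rw [hs' u (by simp) (by simp)] at hu'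
      rw [hs' v (by rw [abs_sub_comm]; omega) (by rw [abs_sub_comm]; omega)] at hv'
      have hsd : s ≤ d := by
        by_contra hlt
        refine huv.symm (sub_left_injective (eq_of_conf_ne_zero hu' hv' ?_ ?_))
        · simp only [Prod.fst_sub, sub_sub_sub_cancel_right]; omega
        · simp only [Prod.snd_sub, sub_sub_sub_cancel_right]; omega
      have hpow : (s : ℤ) ^ 4 ≤ (d : ℤ) ^ 4 := by exact_mod_cast Nat.pow_le_pow_left hsd 4
      by_contra hne
      obtain ⟨⟨a1, a2⟩, ⟨a3, a4⟩, -⟩ := (conf_ne_zero_iff _ _).1 hne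
      obtain ⟨⟨b1, b2⟩, ⟨b3, b4⟩, -⟩ := (conf_ne_zero_iff _ _).1 hu'
      simp only [Prod.fst_sub, Prod.snd_sub] at *
      generalize (s : ℤ) ^ 4 = S at *
      generalize (d : ℤ) ^ 4 = D at *
      rw [lt_abs, lt_abs] at hh
      omega
  -- The radius is at least `d ^ 4`, to see the whole box, and at least `d`, to see both `u` and
  -- `v`.
  obtain ⟨s, t, hst, hout⟩ := key (d ^ 4 + d) (by omega)
  obtain ⟨h, hh⟩ := h2 s t
  apply hh
  have hbig : ¬ ((d : ℤ) ^ 4 < |h.1 - u.1| ∨ (d : ℤ) ^ 4 < |h.2 - u.2|) → False := by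
    intro hc
    push Not at hc
    refine hh (hst h ?_ ?_)
    · push_cast; omega
    · push_cast; omega
  have hbig := not_not.1 hbig
  -- A second window reaching `h` may yield another box, but that box is blank at `h` as well.
  obtain ⟨s', t', hst', hout'⟩ := key (d + (h.1 - u.1).natAbs + (h.2 - u.2).natAbs) (by omega)
  have hn1 := abs_nonneg (h.1 - u.1)
  have hn2 := abs_nonneg (h.2 - u.2)
  rw [hout h hbig, hst' h (by push_cast; omega) (by push_cast; omega), hout' h hbig]

/-! ### Effectiveness -/

/-- The list of cells and letters of the `N × N` array coded by `q`. -/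
def blockCode (N q : ℕ) : List ((ℤ × ℤ) × Fin 3) :=
  (List.range (N * N)).map fun k =>
    ((((k / N : ℕ) : ℤ), ((k % N : ℕ) : ℤ)), Fin.ofNat 3 (digit 3 q k))

theorem mem_blockCode {N q : ℕ} {g : ℤ × ℤ} {a : Fin 3} :
    (g, a) ∈ blockCode N q ↔ ∃ i < N, ∃ j < N, g = ((i : ℤ), (j : ℤ)) ∧
      a = Fin.ofNat 3 (digit 3 q (i * N + j)) := by
  simp only [blockCode, List.mem_map, List.mem_range, Prod.mk.injEq]
  constructor
  · rintro ⟨k, hk, rfl, rfl⟩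
    have hN : 0 < N := Nat.pos_of_ne_zero (by rintro rfl; simp at hk)
    exact ⟨k / N, Nat.div_lt_of_lt_mul hk, k % N, Nat.mod_lt _ hN, rfl, by
      rw [Nat.div_add_mod']⟩
  · rintro ⟨i, hi, j, hj, rfl, rfl⟩
    refine ⟨i * N + j, by nlinarith, ?_, rfl⟩
    rw [mul_comm, Nat.mul_add_div (by omega), Nat.mul_add_mod, Nat.div_eq_of_lt hj,
      Nat.mod_eq_of_lt hj, add_zero]

theorem primrec_intCast : Primrec fun n : ℕ => (n : ℤ) := by
  refine Primrec.encode_iff.1 (Primrec.nat_double.of_eq fun n => ?_)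
  rfl

theorem primrec_blockCode : Primrec₂ blockCode := by
  have hk : Primrec fun x : (ℕ × ℕ) × ℕ => x.2 := Primrec.snd
  have hN : Primrec fun x : (ℕ × ℕ) × ℕ => x.1.1 := Primrec.fst.comp .fst
  have hd := primrec_digit (.const 3) (Primrec.snd.comp Primrec.fst) hk
  refine Primrec.list_map (Primrec.list_range.comp (primrec_mul .fst .fst)) <| Primrec.pair
    (Primrec.pair (primrec_intCast.comp (primrec_div hk hN))
      (primrec_intCast.comp (primrec_mod hk hN)))
    (Primrec.fin_val_iff.1 ((primrec_mod hd (.const 3)).of_eq fun x => ?_))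
  rfl

/-- The forbidden patterns: the square patterns that are not admissible. -/
def badBlocks : Set (Pat (Fin 3)) :=
  {p | ∃ w ∈ {w | ∃ c : ℕ, w = blockCode c.unpair.1 c.unpair.2 ∧ ¬ Good c.unpair.1 c.unpair.2},
    Codes w p}

theorem isREPatternSet_badBlocks : IsREPatternSet badBlocks := by
  refine ⟨_, ?_, rfl⟩
  have h1 : Primrec fun x : List ((ℤ × ℤ) × Fin 3) × ℕ => x.2.unpair.1 := primrec_unpair_fst .snd
  have h2 : Primrec fun x : List ((ℤ × ℤ) × Fin 3) × ℕ => x.2.unpair.2 := primrec_unpair_snd .snd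
  exact rePred_exists_nat
    ((primrecPred_eq .fst (primrec_blockCode.comp h1 h2)).and (primrecPred_good h1 h2).not)

theorem mem_square {n : ℕ} {h : ℤ × ℤ} :
    h ∈ square n ↔ ∃ i < n, ∃ j < n, h = ((i : ℤ), (j : ℤ)) := by
  simp only [square, Finset.mem_product, Finset.mem_Ico]
  constructor
  · rintro ⟨⟨h1, h2⟩, h3, h4⟩
    exact ⟨h.1.toNat, by omega, h.2.toNat, by omega, by ext <;> simp <;> omega⟩
  · rintro ⟨i, hi, j, hj, rfl⟩
    simp only
    omega

theorem forbidden_badBlocks : forbidden badBlocks = sparseBoxes := by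
  ext x
  constructor
  · intro hx
    refine mem_sparseBoxes_of_good fun g N q hq => ?_
    by_contra hbad
    refine hx (Pattern.fromConfig (shift g x) (square N))
      ⟨blockCode N q, ⟨Nat.pair N q, by simpa using hbad⟩, fun h a => ?_⟩ g fun h hh => ?_
    · rw [mem_blockCode]
      simp only [Pattern.fromConfig]
      constructor
      · rintro ⟨i, hi, j, hj, rfl, rfl⟩
        have hs := mem_square.2 ⟨i, hi, j, hj, rfl⟩
        refine ⟨hs, ?_⟩
        rw [if_pos hs, hq i hi j hj, shift_apply]
        apply Fin.ext
        simp
      · rintro ⟨hs, rfl⟩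
        rw [if_pos hs]
        obtain ⟨i, hi, j, hj, rfl⟩ := mem_square.1 hs
        refine ⟨i, hi, j, hj, rfl, ?_⟩
        rw [hq i hi j hj, shift_apply]
        apply Fin.ext
        simp
    · simp only [Pattern.fromConfig] at hh ⊢
      rw [if_pos hh, shift_apply]
  · rintro hx p ⟨w, ⟨c, rfl, hbad⟩, hw⟩ g hocc
    refine hbad (good_of_mem_sparseBoxes hx (g := g) fun i hi j hj => ?_)
    obtain ⟨hs, hp⟩ := (hw _ _).1 (mem_blockCode.2 ⟨i, hi, j, hj, rfl, rfl⟩)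
    rw [hocc _ hs, hp, Fin.val_ofNat, Nat.mod_eq_of_lt (digit_lt (by norm_num) ..)]

/-! ### Block complexity -/

/-- The pattern of the `N × N` block with letters `f`. -/
noncomputable def blockPattern (N : ℕ) (f : ℕ → ℕ → ℕ) : Pat (Fin 3) :=
  Pattern.fromConfig (fun h => Fin.ofNat 3 (f h.1.toNat h.2.toNat)) (square N)

theorem eq_blockPattern {N : ℕ} {p : Pat (Fin 3)} {f : ℕ → ℕ → ℕ} (hp : p.support = square N)
    (h : ∀ i < N, ∀ j < N, f i j = (p.config ((i : ℤ), (j : ℤ))).val) : blockPattern N f = p := by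
  obtain ⟨x, U, hU⟩ := p
  simp only at hp h
  subst hp
  simp only [blockPattern, Pattern.fromConfig, Pattern.mk.injEq, and_true]
  funext g
  split_ifs with hg
  · obtain ⟨i, hi, j, hj, rfl⟩ := mem_square.1 hg
    apply Fin.ext
    simp [h i hi j hj]
  · exact (hU g hg).symm

/-- A finite set of patterns that contains all admissible `N × N` blocks. -/
noncomputable def blockCover (N : ℕ) : Finset (Pat (Fin 3)) := by
  classical
  exact (Finset.range (N + 1) ×ˢ Finset.range (N + 1) ×ˢ Finset.range 3).image
      (fun c => blockPattern N fun i j => if i = c.1 ∧ j = c.2.1 then c.2.2 else 0) ∪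
    (Finset.range (N + 1) ×ˢ Finset.range (N ^ 4 + N + 1) ×ˢ Finset.range (N ^ 4 + N + 1)).image
      (fun c => blockPattern N fun i j => paddedVal c.1 N (i + c.2.1) (j + c.2.2))

theorem card_blockCover_le (N : ℕ) : (blockCover N).card ≤
    (N + 1) * ((N + 1) * 3) + (N + 1) * ((N ^ 4 + N + 1) * (N ^ 4 + N + 1)) := by
  classical
  refine (Finset.card_union_le _ _).trans (add_le_add ?_ ?_) <;>
  · refine Finset.card_image_le.trans ?_
    simp

theorem mem_blockCover {x : ℤ × ℤ → Fin 3} (hx : x ∈ sparseBoxes) {N : ℕ} {p : Pat (Fin 3)}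
    (hp : p.support = square N) {g : ℤ × ℤ} (hocc : p.occursInAt x g) : p ∈ blockCover N := by
  classical
  obtain ⟨q, hq⟩ := exists_codesBlock x g N
  have hqp : ∀ i < N, ∀ j < N, digit 3 q (i * N + j) = (p.config ((i : ℤ), (j : ℤ))).val := by
    intro i hi j hj
    rw [hq i hi j hj, hocc _ (hp ▸ mem_square.2 ⟨i, hi, j, hj, rfl⟩)]
  obtain ⟨u, hu, v, hv, h⟩ | ⟨s, hs, a, ha, b, hb, h⟩ := good_of_mem_sparseBoxes hx hq
  · refine Finset.mem_union_left _ (Finset.mem_image.2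
      ⟨(u, v, digit 3 q (u * N + v)), ?_, eq_blockPattern hp fun i hi j hj => ?_⟩)
    · simp only [Finset.mem_product, Finset.mem_range]
      exact ⟨hu, hv, digit_lt (by norm_num) ..⟩
    · rw [← hqp i hi j hj]
      simp only
      split_ifs with hij
      · rw [hij.1, hij.2]
      · exact (h i hi j hj hij).symm
  · refine Finset.mem_union_right _ (Finset.mem_image.2
      ⟨(s, a, b), ?_, eq_blockPattern hp fun i hi j hj => ?_⟩)
    · simp only [Finset.mem_product, Finset.mem_range]
      exact ⟨hs, ha, hb⟩
    · rw [← hqp i hi j hj, h i hi j hj]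

theorem encard_admissibleBlocks_le {S : Subshift (Fin 3) (ℤ × ℤ)} (hS : S.carrier = sparseBoxes)
    (N : ℕ) : (admissibleBlocks S N).encard ≤
      ((N + 1) * ((N + 1) * 3) + (N + 1) * ((N ^ 4 + N + 1) * (N ^ 4 + N + 1)) : ℕ) := by
  have h : admissibleBlocks S N ⊆ (blockCover N : Set (Pat (Fin 3))) := by
    rintro p ⟨hp, x, hx, g, hocc⟩
    exact mem_blockCover (hS ▸ hx) hp hocc
  refine (Set.encard_le_encard h).trans ?_
  rw [Set.encard_coe_eq_coe_finsetCard]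
  exact_mod_cast card_blockCover_le N

/-! ### Non-soficness -/

theorem eq_of_cell_eq {s : ℕ} (hs : 0 < s) {p p' : ℕ} (hp : p < 2 ^ s ^ 6) (hp' : p' < 2 ^ s ^ 6)
    (h : ∀ i < s ^ 4, ∀ j < s ^ 4, cell s p i j = cell s p' i j) : p = p' := by
  refine eq_of_digit_eq (s ^ 6) hp hp' fun k hk => ?_
  have hs3 : 0 < s ^ 3 := by positivity
  have h1 : k / s ^ 3 < s ^ 3 := Nat.div_lt_of_lt_mul (by rw [← pow_add]; exact hk)
  have h2 : k % s ^ 3 < s ^ 3 := Nat.mod_lt _ hs3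
  have h4 : s ^ 4 = s ^ 3 * s := pow_succ s 3
  -- The cell that stores bit `k`: each row of the box has `s ^ 3` marked cells.
  have := h (k / s ^ 3 * s) (by rw [h4]; exact Nat.mul_lt_mul_of_pos_right h1 hs)
    (k % s ^ 3 * s) (by rw [h4]; exact Nat.mul_lt_mul_of_pos_right h2 hs)
  simp only [cell, Nat.mul_mod_left, and_self, if_true, Nat.mul_div_cancel _ hs,
    Nat.div_add_mod'] at this
  omega

/-- The letters near the boundary of an `n × n` array. -/
def boundary (M R n Q : ℕ) (hM : 0 < M) (x : Fin 4 × Fin R × Fin n) : Fin M :=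
  ⟨![digit M Q (x.2.1 * n + x.2.2), digit M Q ((n - 1 - x.2.1) * n + x.2.2),
    digit M Q (x.2.2 * n + x.2.1), digit M Q (x.2.2 * n + (n - 1 - x.2.1))] x.1, by
      obtain ⟨i, -, -⟩ := x
      fin_cases i <;> exact digit_lt hM ..⟩

theorem agreeNearBoundary_of_boundary_eq {M R n Q Q' : ℕ} (hM : 0 < M)
    (h : boundary M R n Q hM = boundary M R n Q' hM) : AgreeNearBoundary M R n Q Q' := by
  have key : ∀ (k : Fin 4) (a : Fin R) (j : Fin n), _ := fun k a j =>
    congrArg Fin.val (congrFun h (k, a, j))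
  intro i hi j hj hij
  rcases hij with (hb | hb) | (hb | hb)
  · exact key 0 ⟨i, hb⟩ ⟨j, hj⟩
  · exact key 2 ⟨j, hb⟩ ⟨i, hi⟩
  · have := key 1 ⟨n - 1 - i, by omega⟩ ⟨j, hj⟩
    have e : n - 1 - (n - 1 - i) = i := by omega
    simpa [boundary, e] using this
  · have := key 3 ⟨n - 1 - j, by omega⟩ ⟨i, hi⟩
    have e : n - 1 - (n - 1 - j) = j := by omega
    simpa [boundary, e] using this

/-- Pigeonhole: if every content were determined by the strip of some preimage, these strips would
inject `2 ^ s ^ 6` contents into at most `M ^ (4 * R * s ^ 4)` strips. -/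
theorem exists_not_determined {M R s : ℕ} (f c : ℕ) (hM : 0 < M) (hs : 4 * R * M < s ^ 2) :
    ∃ p < 2 ^ s ^ 6, ¬ Determined M R f c s p := by
  have hs0 : 0 < s := Nat.pos_of_ne_zero (by rintro rfl; simp at hs)
  by_contra! hall
  choose! Q hlt hQ hdet using hall
  have hinj : Function.Injective fun p : Fin (2 ^ s ^ 6) => boundary M R (s ^ 4) (Q p) hM := by
    intro p p' h
    have ha := agreeNearBoundary_of_boundary_eq hM h
    have hp := hdet p p.2 (Q p') (hlt p' p'.2) (hQ p' p'.2).1 ha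
    have hp' := (hQ p' p'.2).2
    exact Fin.ext (eq_of_cell_eq hs0 p.2 p'.2 fun i hi j hj => by
      rw [← hp i hi j hj, hp' i hi j hj])
  have hcard := Fintype.card_le_of_injective _ hinj
  simp only [Fintype.card_fin, Fintype.card_fun, Fintype.card_prod] at hcard
  -- The crude bound `M ≤ 2 ^ M` avoids logarithms.
  have h2 : M ^ (4 * (R * s ^ 4)) ≤ 2 ^ (M * (4 * (R * s ^ 4))) := by
    rw [pow_mul 2]
    exact Nat.pow_le_pow_left Nat.lt_two_pow_self.le _
  have h3 := (Nat.pow_le_pow_iff_right (by norm_num)).1 (hcard.trans h2)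
  have h4 : 4 * R * M * s ^ 4 < s ^ 2 * s ^ 4 := Nat.mul_lt_mul_of_pos_right hs (by positivity)
  nlinarith

theorem not_determined_payload (m R f c : ℕ) :
    ∃ s, 2 ≤ s ∧ ¬ Determined (m + 1) R f c s (payload s) := by
  classical
  -- The last component is padding: decoding ignores it, and it makes `s` large enough for the
  -- counting bound.
  set s := Nat.pair (Nat.pair (Nat.pair m R) (Nat.pair f c)) (4 * R * (m + 1) + 2) with hs
  have hle : 4 * R * (m + 1) + 2 ≤ s := Nat.right_le_pair _ _
  have hdet : ∀ p, DeterminedAt s p ↔ Determined (m + 1) R f c s p := fun p => by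
    simp [DeterminedAt, hs]
  refine ⟨s, by omega, ?_⟩
  obtain ⟨p, hp, hnot⟩ := exists_not_determined (s := s) (R := R) f c m.succ_pos (by nlinarith)
  rw [← hdet] at hnot ⊢
  exact Nat.findGreatest_spec (P := fun p => ¬ DeterminedAt s p) (by omega) hnot

theorem conf_natCast {s i j : ℕ} (hi : i < s ^ 4) (hj : j < s ^ 4) :
    (conf s ((i : ℤ), (j : ℤ))).val = cell s (payload s) i j := by
  simp [conf, confVal, boxVal, hi, hj]

/-- A configuration of the shift that agrees with a box outside the open quadrant is that box. -/
theorem eq_conf_of_mem_sparseBoxes {x : ℤ × ℤ → Fin 3} (hx : x ∈ sparseBoxes) {s : ℕ} (hs : 2 ≤ s)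
    (h : ∀ u : ℤ × ℤ, u.1 ≤ 0 ∨ u.2 ≤ 0 → x u = conf s u) : x = conf s := by
  have hlt : ∀ n : ℕ, 2 ≤ n → (n : ℤ) < (n : ℤ) ^ 4 := fun n hn => by
    exact_mod_cast lt_self_pow₀ (by omega : 1 < n) (by norm_num : 1 < 4)
  have h00 : x (0, 0) ≠ 0 := by
    rw [h _ (by simp), conf_ne_zero_iff]
    have := hlt s hs
    simp only [dvd_zero, and_true]
    omega
  have hs0 : x ((s : ℤ), 0) ≠ 0 := by
    rw [h _ (by simp), conf_ne_zero_iff]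
    have := hlt s hs
    simp only [dvd_zero, dvd_refl, and_true]
    omega
  obtain ⟨u, hu⟩ | ⟨s', t, ht⟩ := hx
  · exfalso
    have e1 : ((0 : ℤ), (0 : ℤ)) = u := by by_contra hne; exact h00 (hu _ hne)
    have e2 : ((s : ℤ), (0 : ℤ)) = u := by by_contra hne; exact hs0 (hu _ hne)
    have := congrArg Prod.fst (e2.trans e1.symm)
    simp at this
    omega
  · have c00 := h00
    rw [ht, conf_ne_zero_iff] at c00
    simp only [Prod.fst_sub, Prod.snd_sub, zero_sub] at c00
    -- The corner `t` of the box of `x` has nonpositive coordinates, as that box covers the origin.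
    -- There `x` agrees with `conf s`, whose nonblank cells have nonnegative coordinates, so `t =
    -- 0`.
    have hst : x t ≠ 0 := by
      rw [ht, sub_self, conf_ne_zero_iff]
      simp only [Prod.fst_zero, Prod.snd_zero, dvd_zero, and_true]
      omega
    rw [h t (by omega), conf_ne_zero_iff] at hst
    have ht0 : t = 0 := Prod.ext (by simp; omega) (by simp; omega)
    subst ht0
    simp only [sub_zero] at ht
    have d1 := hs0
    rw [ht, conf_ne_zero_iff] at d1
    simp only at d1
    have hs' : 2 ≤ s' := by
      by_contra hlt'
      have : s' = 0 ∨ s' = 1 := by omega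
      rcases this with rfl | rfl
      · simp at d1
      · simp at d1; omega
    have d2 : x ((s' : ℤ), 0) ≠ 0 := by
      rw [ht, conf_ne_zero_iff]
      have := hlt s' hs'
      simp only [dvd_zero, dvd_refl, and_true]
      omega
    rw [h _ (by simp), conf_ne_zero_iff] at d2
    -- Each spacing marks a cell on the axis `h.2 = 0`, where both boxes agree, so each divides the
    -- other.
    have : s' = s := Nat.dvd_antisymm (Int.natCast_dvd_natCast.1 d1.2.2.1)
      (Int.natCast_dvd_natCast.1 d2.2.2.1)
    subst this
    exact funext ht

/-! ### Finite-type shifts as window constraints, and surgery -/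

/-- The window coded by `v`, centered at the origin and of radius `r`, contains no pattern
of `F`. -/
def AllowedWindow {m : ℕ} (F : Set (Pat (Fin (m + 1)))) (r v : ℕ) : Prop :=
  ∀ p ∈ F, ∃ h ∈ p.support,
    digit (m + 1) v ((h.1 + r).toNat * (2 * r + 1) + (h.2 + r).toNat) ≠ (p.config h).val

/-- The number `v` codes the `R × R` window of `z` at `o`. -/
def CodesWindow {m : ℕ} (z : ℤ × ℤ → Fin (m + 1)) (o : ℤ × ℤ) (R v : ℕ) : Prop :=
  ∀ a < R, ∀ b < R, digit (m + 1) v (a * R + b) = (z (o + ((a : ℤ), (b : ℤ)))).val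

/-- Patterns of radius `r` are tested one window of side `2 * r + 1` at a time, so the finite-type
condition is a finite table, which the number `f` can encode. The window with corner `o` is centered
at `o + (r, r)`. -/
theorem mem_forbidden_iff_allowedWindow {m r : ℕ} {F : Set (Pat (Fin (m + 1)))}
    (hF : ∀ p ∈ F, ∀ h ∈ p.support, |h.1| ≤ r ∧ |h.2| ≤ r) (z : ℤ × ℤ → Fin (m + 1)) :
    z ∈ forbidden F ↔ ∀ o, ∀ v < (m + 1) ^ ((2 * r + 1) * (2 * r + 1)),
      CodesWindow z o (2 * r + 1) v → AllowedWindow F r v := by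
  have key : ∀ {o v}, CodesWindow z o (2 * r + 1) v → ∀ p ∈ F, ∀ h ∈ p.support,
      digit (m + 1) v ((h.1 + r).toNat * (2 * r + 1) + (h.2 + r).toNat) =
        (z (o + ((r : ℤ), (r : ℤ)) + h)).val := by
    intro o v hv p hp h hh
    have := hF p hp h hh
    rw [abs_le, abs_le] at this
    rw [hv _ (by omega) _ (by omega)]
    congr 2
    ext <;> simp <;> omega
  constructor
  · intro hz o v _ hv p hp
    by_contra! hne
    exact hz p hp (o + ((r : ℤ), (r : ℤ))) fun h hh =>
      Fin.ext (by rw [← key hv p hp h hh, hne h hh])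
  · intro hall p hp g hocc
    obtain ⟨v, hlt, hv⟩ := exists_digit_square (B := m + 1) m.succ_pos (2 * r + 1)
      (fun a b => (z (g - ((r : ℤ), (r : ℤ)) + ((a : ℤ), (b : ℤ)))).val) fun _ _ _ _ => Fin.is_lt _
    obtain ⟨h, hh, hne⟩ := hall (g - ((r : ℤ), (r : ℤ))) v hlt hv p hp
    refine hne ?_
    rw [key hv p hp h hh, sub_add_cancel]
    exact congrArg Fin.val (hocc h hh)

theorem exists_radius {m : ℕ} {F : Set (Pat (Fin (m + 1)))} (hF : F.Finite) :
    ∃ r : ℕ, ∀ p ∈ F, ∀ h ∈ p.support, |h.1| ≤ r ∧ |h.2| ≤ r := by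
  classical
  refine ⟨(hF.toFinset.biUnion Pattern.support).sup fun h => h.1.natAbs + h.2.natAbs,
    fun p hp h hh => ?_⟩
  have := Finset.le_sup (f := fun h : ℤ × ℤ => h.1.natAbs + h.2.natAbs)
    (Finset.mem_biUnion.2 ⟨p, hF.mem_toFinset.2 hp, hh⟩)
  rw [Int.abs_eq_natAbs, Int.abs_eq_natAbs]
  omega

/-- The configuration `y` with its `n × n` block at the origin replaced by the array coded
by `Q`. -/
def replaceBox {m : ℕ} (y : ℤ × ℤ → Fin (m + 1)) (n Q : ℕ) (h : ℤ × ℤ) : Fin (m + 1) :=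
  if (0 ≤ h.1 ∧ h.1 < n) ∧ 0 ≤ h.2 ∧ h.2 < n then
    Fin.ofNat (m + 1) (digit (m + 1) Q (h.1.toNat * n + h.2.toNat))
  else y h

theorem val_replaceBox {m : ℕ} (y : ℤ × ℤ → Fin (m + 1)) {n i j : ℕ} (Q : ℕ) (hi : i < n)
    (hj : j < n) :
    (replaceBox y n Q ((i : ℤ), (j : ℤ))).val = digit (m + 1) Q (i * n + j) := by
  simp [replaceBox, hi, hj, Nat.mod_eq_of_lt (digit_lt m.succ_pos _ _)]

theorem replaceBox_eq {m : ℕ} {y : ℤ × ℤ → Fin (m + 1)} {R n Q Q' : ℕ}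
    (hQ : ∀ i < n, ∀ j < n, digit (m + 1) Q (i * n + j) = (y ((i : ℤ), (j : ℤ))).val)
    (hag : AgreeNearBoundary (m + 1) R n Q Q') {h : ℤ × ℤ}
    (hh : (h.1 < R ∨ h.2 < R) ∨ ((n : ℤ) ≤ h.1 + R ∨ (n : ℤ) ≤ h.2 + R)) :
    replaceBox y n Q' h = y h := by
  by_cases hbox : (0 ≤ h.1 ∧ h.1 < n) ∧ 0 ≤ h.2 ∧ h.2 < n
  · obtain ⟨a, b⟩ := h
    simp only at hh hbox
    obtain ⟨⟨h1, h2⟩, h3, h4⟩ := hbox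
    lift a to ℕ using h1
    lift b to ℕ using h3
    have ha : a < n := by omega
    have hb : b < n := by omega
    apply Fin.ext
    rw [val_replaceBox _ _ ha hb, ← hag a ha b hb (by omega), hQ a ha b hb]
  · rw [replaceBox, if_neg hbox]

theorem not_isSofic_of_carrier_eq {S : Subshift (Fin 3) (ℤ × ℤ)} (hS : S.carrier = sparseBoxes) :
    ¬ IsSofic S := by
  classical
  rintro ⟨m, T, π, ⟨F, hF, hT⟩, hST⟩
  obtain ⟨r, hr⟩ := exists_radius hF
  -- `f` is the table of allowed windows and `c`, below, the table of the projection: with `m` and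
  -- `r` they are the data that `s` encodes.
  obtain ⟨f, -, hf⟩ := exists_digit_eq (B := 2) (by norm_num)
    ((m + 1) ^ ((2 * r + 1) * (2 * r + 1))) (fun v => if AllowedWindow F r v then 1 else 0)
    fun v _ => by split <;> norm_num
  obtain ⟨c, -, hc⟩ := exists_digit_eq (B := 3) (by norm_num) (m + 1)
    (fun a => (π (Fin.ofNat (m + 1) a)).val) fun a _ => Fin.is_lt _
  have hcv : ∀ a : Fin (m + 1), digit 3 c a.val = (π a).val := fun a => by
    rw [hc a.val a.is_lt]; simp
  obtain ⟨s, hs2, hnot⟩ := not_determined_payload m (2 * r + 1) f c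
  have hmem : conf s ∈ S.carrier := hS ▸ Or.inr ⟨s, 0, fun h => by rw [sub_zero]⟩
  rw [hST] at hmem
  obtain ⟨y, hyT, hy⟩ := hmem
  rw [hT, mem_forbidden_iff_allowedWindow hr] at hyT
  obtain ⟨Q, hQlt, hQ⟩ := exists_digit_square (B := m + 1) m.succ_pos (s ^ 4)
    (fun i j => (y ((i : ℤ), (j : ℤ))).val) fun _ _ _ _ => Fin.is_lt _
  have hvalid : Valid (m + 1) (2 * r + 1) f (s ^ 4) Q := by
    intro i hi j hj hij v hv hw
    rw [hf v hv, if_pos]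
    refine hyT ((i : ℤ), (j : ℤ)) v hv fun a ha b hb => ?_
    rw [hw a ha b hb, hQ _ (by omega) _ (by omega)]
    simp
  have hproj : Projects (m + 1) c s (payload s) Q := by
    intro i hi j hj
    rw [hQ i hi j hj, hcv, ← conf_natCast hi hj, ← hy]
    rfl
  refine hnot ⟨Q, hQlt, ⟨hvalid, hproj⟩, fun Q' _ hvalid' hag i hi j hj => ?_⟩
  have hz : replaceBox y (s ^ 4) Q' ∈ T.carrier := by
    rw [hT, mem_forbidden_iff_allowedWindow hr]
    intro o v hv hw
    -- A window inside the box is allowed because `Q'` is valid. Any other window meets the box only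
    -- within the strip, where nothing has changed.
    by_cases hin : (0 ≤ o.1 ∧ 0 ≤ o.2) ∧
        o.1 + (2 * r + 1 : ℕ) ≤ (s ^ 4 : ℕ) ∧ o.2 + (2 * r + 1 : ℕ) ≤ (s ^ 4 : ℕ)
    · obtain ⟨a, b⟩ := o
      obtain ⟨⟨h1, h2⟩, h3, h4⟩ := hin
      simp only at h1 h2 h3 h4
      lift a to ℕ using h1
      lift b to ℕ using h2
      have := hvalid' a (by omega) b (by omega) (by omega) v hv fun a' ha' b' hb' => by
        rw [hw a' ha' b' hb', ← val_replaceBox y _ (by omega) (by omega)]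
        simp
      rw [hf v hv] at this
      by_contra hno
      rw [if_neg hno] at this
      exact absurd this (by norm_num)
    · refine hyT o v hv fun a ha b hb => ?_
      rw [hw a ha b hb, replaceBox_eq hQ hag]
      simp only [Prod.fst_add, Prod.snd_add]
      omega
  have hzS : π ∘ replaceBox y (s ^ 4) Q' ∈ sparseBoxes := by
    rw [← hS, hST]
    exact ⟨_, hz, rfl⟩
  -- The strip has width `2 * r + 1 ≥ 1`, so the cells on the axes are preserved even when `r = 0`.
  have heq := eq_conf_of_mem_sparseBoxes hzS hs2 fun u hu => by
    rw [Function.comp_apply, replaceBox_eq hQ hag (by omega), ← hy]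
    rfl
  rw [← val_replaceBox y Q' hi hj, hcv, ← conf_natCast hi hj, ← heq]
  rfl

end PlaneShift

theorem mainTheorem5 :
    ∃ (k : ℕ) (S : Subshift (Fin (k + 1)) (ℤ × ℤ)),
      S.carrier.Nonempty ∧
      PlaneShift.IsEffective S ∧
      ¬ PlaneShift.IsSofic S ∧
      ∃ P : Polynomial ℕ, ∀ n : ℕ,
        (PlaneShift.admissibleBlocks S n).encard ≤ (P.eval n : ℕ) := by
  have hS : (Subshift.ofForbidden PlaneShift.badBlocks).carrier = PlaneShift.sparseBoxes :=
    PlaneShift.forbidden_badBlocks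
  refine ⟨2, Subshift.ofForbidden PlaneShift.badBlocks, ?_,
    ⟨PlaneShift.badBlocks, PlaneShift.isREPatternSet_badBlocks, rfl⟩,
    PlaneShift.not_isSofic_of_carrier_eq hS, ?_⟩
  · rw [hS]
    exact ⟨0, .inl ⟨0, fun _ _ => rfl⟩⟩
  · refine ⟨(.X + 1) * ((.X + 1) * 3) +
      (.X + 1) * ((.X ^ 4 + .X + 1) * (.X ^ 4 + .X + 1)), fun n => ?_⟩
    refine (PlaneShift.encard_admissibleBlocks_le hS n).trans_eq ?_
    simp
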